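/- Let $G$ be a finite group, $N$ a normal subgroup of $G$ and $p$ a prime. Let $\mathrm{Irr}(N)$ be the set of irreducible complex characters of $N$, on which $G$ acts by conjugation, $\theta^g(x)=\theta(gxg^{-1})$. For $\theta\in\mathrm{Irr}(N)$ let $\widehat{\theta}$ be the sum of the distinct $G$-conjugates of $\theta$; put $\mathrm{Min}_G(N)=\{\widehat{\theta}\mid\theta\in\mathrm{Irr}(N)\}$ (the minimal $G$-invariant characters of $N$) and $\mathrm{Lin}_G(N)=\{\theta\in\mathrm{Irr}(N)\mid \theta(1)=1 \text{ and } \theta^g=\theta \text{ for all } g\in G\}$ (the linear $G$-invariant characters of $N$). If $p$ divides $\widehat{\theta}(1)$ for every $\widehat{\theta}\in\mathrm{Min}_G(N)\setminus\mathrm{Lin}_G(N)$, then $N$ has a normal $p$-complement, that is, a normal subgroup $K$ of $N$ such that $p\nmid|K|$ and $|N:K|$ is a power of $p$. -/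

import Mathlib

/-- `Irr H`: the irreducible complex characters of a group `H`, as functions `H → ℂ`, that is the
traces of the irreducible representations of `H` on the spaces `ℂⁿ`. -/
def Irr (H : Type*) [Group H] : Set (H → ℂ) :=
  {θ | ∃ (n : ℕ) (ρ : Representation ℂ H (Fin n → ℂ)), ρ.IsIrreducible ∧ ρ.character = θ}

section MinimalInvariant

variable {G : Type*} [Group G] {N : Subgroup G} [N.Normal]

/-- The conjugate `θ ^ g` of a function on the normal subgroup `N`:
`θ ^ g (x) = θ (g * x * g⁻¹)`. -/
def conjFun (θ : N → ℂ) (g : G) : N → ℂ :=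
  fun x => θ (MulAut.conjNormal g x)

/-- The orbit sum: each of the distinct `G`-conjugates of `θ` is counted once. -/
noncomputable def orbitSum [Finite G] (θ : N → ℂ) : N → ℂ :=
  ∑ φ ∈ (Set.finite_range (conjFun (G := G) θ)).toFinset, φ

end MinimalInvariant

/-- The set of minimal `G`-invariant characters of `N`: the orbit sums of the irreducible
characters of `N`. -/
def MinInvChar {G : Type*} [Group G] [Finite G] (N : Subgroup G) [N.Normal] : Set (N → ℂ) :=
  {ψ | ∃ θ ∈ Irr N, ψ = orbitSum θ}

/-- The set of linear `G`-invariant irreducible characters of `N`. -/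
def LinInvChar {G : Type*} [Group G] (N : Subgroup G) [N.Normal] : Set (N → ℂ) :=
  {θ | θ ∈ Irr N ∧ θ 1 = 1 ∧ ∀ g : G, conjFun θ g = θ}

/-- `H` has a normal `p`-complement: a normal subgroup of order prime to `p` and of index
a power of `p`. -/
def HasNormalPComplement (p : ℕ) (H : Type*) [Group H] : Prop :=
  ∃ K : Subgroup H, K.Normal ∧ (Nat.card K).Coprime p ∧ ∃ k : ℕ, K.index = p ^ k

/-!
Let `M = O^p(N)` be the subgroup generated by the elements of `N` of order prime to `p`. It is
normal in `G` and `N / M` is a `p`-group, so it suffices to prove `p ∤ |M|`; then `M` is the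
normal `p`-complement.

The hypothesis on `N` descends to `M`. Let `φ` be an irreducible character of `M` whose orbit sum
has degree prime to `p`. The length of its `G`-orbit is prime to `p`, while the orbits of `N` on it
have equal lengths, powers of `p`; hence `N` fixes `φ` (`le_inertiaGroup`). Homomorphisms from `M`
to `ℂˣ` have order prime to `p` (`pResidual_hom_pow_eq_one`), so both the degree and the
determinantal order of `φ` are prime to `p`, and `φ` extends to a character `θ` of `N` of
determinantal order prime to `p` (`Representation.exists_extension`). There is only one such `θ`
(`Representation.character_eq_of_extensions`), so whatever fixes `φ` fixes `θ`, and the orbit sum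
of `θ` has degree prime to `p`. By hypothesis it is a linear invariant character, so `θ` is linear
and invariant, and so is `φ` (`mem_LinInvChar_of_not_dvd`).

Now count modulo `p`: in `|M| = ∑ φ(1) ^ 2` (`exists_irr_enumeration`) each orbit of characters that
are not linear and invariant contributes a multiple of `p`, so `|M|` is congruent to the number of
linear invariant characters of `M` (`dvd_ncard_LinInvChar`). These form a group. If `p` divided
`|M|`, this group would have an element of order `p`, which `M = O^p(N)` does not admit.

For the extension, consider the pairs `(x, T)` with `x ∈ N` and `T` an operator carrying the
representation of `M` to its `x`-conjugate, normalised by a condition on the determinant. They form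
a finite group which maps onto `N` with a central kernel of scalars of order prime to `p`. The
product of a Sylow `p`-subgroup with the copy of `M` inside this group meets the kernel trivially
and maps onto `N`, so it is the graph of an extension.
-/

/-! ### Irreducible characters and the sum of the squares of their degrees -/

theorem Representation.isIrreducible_iff_submodule {k H V : Type*} [Field k] [Monoid H]
    [AddCommGroup V] [Module k V] (ρ : Representation k H V) :
    ρ.IsIrreducible ↔ Nontrivial V ∧
      ∀ W : Submodule k V, (∀ g, ∀ v ∈ W, ρ g v ∈ W) → W = ⊥ ∨ W = ⊤ := by
  constructor
  · intro h
    refine ⟨?_, fun W hW => ?_⟩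
    · by_contra hV
      rw [not_nontrivial_iff_subsingleton] at hV
      apply bot_ne_top (α := Subrepresentation ρ)
      apply Subrepresentation.toSubmodule_injective
      exact Subsingleton.elim _ _
    · rcases eq_bot_or_eq_top (⟨W, fun g v hv => hW g v hv⟩ : Subrepresentation ρ) with h' | h'
      · exact Or.inl (congrArg Subrepresentation.toSubmodule h')
      · exact Or.inr (congrArg Subrepresentation.toSubmodule h')
  · rintro ⟨hV, h⟩
    have : Nontrivial (Subrepresentation ρ) :=
      ⟨⊥, ⊤, fun h => bot_ne_top (α := Submodule k V)
        (congrArg Subrepresentation.toSubmodule h)⟩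
    refine ⟨fun W => ?_⟩
    rcases h W.toSubmodule (fun g v hv => W.apply_mem_toSubmodule g hv) with h' | h'
    · exact Or.inl (Subrepresentation.toSubmodule_injective h')
    · exact Or.inr (Subrepresentation.toSubmodule_injective h')

/-- A representation whose extension to the group algebra is onto a full matrix algebra is
irreducible. -/
theorem Representation.isIrreducible_of_surjective {H : Type*} [Monoid H] {n : ℕ} [NeZero n]
    (ρ : Representation ℂ H (Fin n → ℂ)) (hρ : Function.Surjective ρ.asAlgebraHom) :
    ρ.IsIrreducible := by
  rw [Representation.isIrreducible_iff_submodule]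
  refine ⟨inferInstance, fun W hW => ?_⟩
  rw [or_iff_not_imp_left]
  intro hne
  obtain ⟨v, hvW, hv0⟩ := W.ne_bot_iff.mp hne
  obtain ⟨j, hj⟩ := Function.ne_iff.mp hv0
  have key : ∀ a : MonoidAlgebra ℂ H, ∀ v ∈ W, ρ.asAlgebraHom a v ∈ W := by
    intro a v hv
    induction a using MonoidAlgebra.induction_on with
    | of g => simpa using hW g v hv
    | add f g hf hg => simpa using W.add_mem hf hg
    | smul r f hf => simpa using W.smul_mem r hf
  refine eq_top_iff.mpr fun w _ => ?_
  -- A rank one operator carries `v` to any prescribed vector.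
  obtain ⟨a, ha⟩ := hρ (((LinearMap.proj j : (Fin n → ℂ) →ₗ[ℂ] ℂ).smulRight ((v j)⁻¹ • w)))
  have := key a v hvW
  rw [ha] at this
  simpa [smul_smul, mul_inv_cancel₀ hj] using this

/-- A linear functional on a matrix algebra which vanishes on commutators is a multiple of the
trace. -/
theorem Matrix.exists_eq_mul_trace_of_map_mul_comm {n : Type*} [Fintype n] [DecidableEq n]
    [Nonempty n] (f : Matrix n n ℂ →ₗ[ℂ] ℂ) (hf : ∀ A B, f (A * B) = f (B * A)) :
    ∃ c : ℂ, ∀ A, f A = c * A.trace := by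
  classical
  let i₀ : n := Classical.arbitrary n
  refine ⟨f (Matrix.single i₀ i₀ 1), fun A => ?_⟩
  have h1 : ∀ i j, f (Matrix.single i j 1) = if i = j then f (Matrix.single i₀ i₀ 1) else 0 := by
    intro i j
    have e1 : Matrix.single i j (1 : ℂ) = Matrix.single i i₀ 1 * Matrix.single i₀ j 1 := by simp
    rw [e1, hf]
    split_ifs with h
    · subst h; simp
    · rw [Matrix.single_mul_single_of_ne _ _ _ _ (Ne.symm h), map_zero]
  conv_lhs => rw [Matrix.matrix_eq_sum_single A]
  simp only [map_sum]
  have h2 : ∀ i j, f (Matrix.single i j (A i j)) =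
      if i = j then f (Matrix.single i₀ i₀ 1) * A i j else 0 := by
    intro i j
    have : Matrix.single i j (A i j) = A i j • Matrix.single i j (1 : ℂ) := by simp
    rw [this, map_smul, h1]
    split_ifs <;> simp [mul_comm]
  simp [h2, Matrix.trace, Finset.mul_sum]

/-- A linear functional on a product of matrix algebras which vanishes on commutators is a
combination of the traces of the blocks. -/
theorem Matrix.exists_eq_sum_mul_trace_of_map_mul_comm {ι : Type*} [Fintype ι] {d : ι → ℕ}
    [∀ i, NeZero (d i)] (f : (∀ i, Matrix (Fin (d i)) (Fin (d i)) ℂ) →ₗ[ℂ] ℂ)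
    (hf : ∀ A B, f (A * B) = f (B * A)) :
    ∃ c : ι → ℂ, ∀ A, f A = ∑ i, c i * (A i).trace := by
  classical
  have hc (i) : ∃ c : ℂ, ∀ A, f (Pi.single i A) = c * A.trace := by
    refine Matrix.exists_eq_mul_trace_of_map_mul_comm
      (f ∘ₗ LinearMap.single ℂ (fun i => Matrix (Fin (d i)) (Fin (d i)) ℂ) i) fun A B => ?_
    simp only [LinearMap.comp_apply, LinearMap.coe_single, Pi.single_mul]
    exact hf _ _
  choose c hc using hc
  refine ⟨c, fun A => ?_⟩
  conv_lhs => rw [← Finset.univ_sum_single A]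
  rw [map_sum]
  exact Finset.sum_congr rfl fun i _ => hc i _

/-- Irreducible representations of a finite group with the same character are equivalent. -/
theorem Representation.nonempty_equiv_of_character_eq {H V W : Type*} [Group H] [Finite H]
    [AddCommGroup V] [Module ℂ V] [FiniteDimensional ℂ V]
    [AddCommGroup W] [Module ℂ W] [FiniteDimensional ℂ W]
    (ρ : Representation ℂ H V) (σ : Representation ℂ H W)
    (hρ : ρ.IsIrreducible) (hσ : σ.IsIrreducible)
    (h : ρ.character = σ.character) : Nonempty (ρ.Equiv σ) := by
  classical
  have := Fintype.ofFinite H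
  have : Invertible (Nat.card H : ℂ) := invertibleOfNonzero (by simp)
  by_contra hne
  have h1 := Representation.char_orthonormal σ ρ
  have h2 := Representation.char_orthonormal σ σ
  rw [if_neg hne, h] at h1
  rw [if_pos ⟨Representation.Equiv.refl σ⟩, h1] at h2
  exact zero_ne_one h2

/-- The regular representation contains each irreducible representation as often as its degree:
the irreducible characters are finitely many, and the squares of their degrees add up to the
order of the group. -/
theorem exists_irr_enumeration (H : Type*) [Group H] [Finite H] :
    ∃ (k : ℕ) (d : Fin k → ℕ) (χ : Fin k → H → ℂ), Function.Injective χ ∧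
      Set.range χ = Irr H ∧ (∀ i, χ i 1 = d i) ∧ ∑ i, d i ^ 2 = Nat.card H := by
  classical
  have := Fintype.ofFinite H
  have hinv : Invertible (Nat.card H : ℂ) := invertibleOfNonzero (by simp)
  have : NeZero (Nat.card H : ℂ) := ⟨by simp⟩
  obtain ⟨k, d, hd, ⟨e⟩⟩ :=
    IsSemisimpleRing.exists_algEquiv_pi_matrix_of_isAlgClosed ℂ (MonoidAlgebra ℂ H)
  let pr (i : Fin k) : MonoidAlgebra ℂ H →ₐ[ℂ] Matrix (Fin (d i)) (Fin (d i)) ℂ :=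
    (Pi.evalAlgHom ℂ _ i).comp e.toAlgHom
  have hpr (i) : Function.Surjective (pr i) :=
    (Function.surjective_eval i).comp e.surjective
  let R (i : Fin k) : Representation ℂ H (Fin (d i) → ℂ) :=
    ((Matrix.toLinAlgEquiv'.toAlgHom.comp (pr i) :
      MonoidAlgebra ℂ H →ₐ[ℂ] Module.End ℂ (Fin (d i) → ℂ)) : _ →* _).comp (MonoidAlgebra.of ℂ H)
  have hR (i) : (R i).asAlgebraHom = Matrix.toLinAlgEquiv'.toAlgHom.comp (pr i) := by
    ext; simp [R]
  have hirr (i) : (R i).IsIrreducible := by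
    apply Representation.isIrreducible_of_surjective
    rw [hR]
    exact Matrix.toLinAlgEquiv'.surjective.comp (hpr i)
  have hchar (i) (h : H) : (R i).character h = (pr i (MonoidAlgebra.of ℂ H h)).trace := by
    simp only [Representation.character, R]
    exact Matrix.trace_toLin'_eq _
  refine ⟨k, d, fun i => (R i).character, ?_, ?_, ?_, ?_⟩
  · intro i j hij
    by_contra hne
    have h1 : (Matrix.traceLinearMap _ ℂ ℂ) ∘ₗ (pr i).toLinearMap =
        (Matrix.traceLinearMap _ ℂ ℂ) ∘ₗ (pr j).toLinearMap := by
      ext h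
      have := congrFun hij h
      simp only [hchar] at this
      simpa using this
    have h2 := LinearMap.congr_fun h1 (e.symm (Pi.single i 1))
    simp [pr, Pi.single_eq_of_ne (Ne.symm hne)] at h2
    exact NeZero.ne _ h2
  · apply Set.Subset.antisymm
    · rintro _ ⟨i, rfl⟩
      exact ⟨d i, R i, hirr i, rfl⟩
    · rintro _ ⟨n, ρ, hρ, rfl⟩
      by_contra hno
      -- The trace of `ρ` is a combination of the block traces, to which `ρ` is orthogonal.
      let f : (∀ i, Matrix (Fin (d i)) (Fin (d i)) ℂ) →ₗ[ℂ] ℂ :=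
        (LinearMap.trace ℂ (Fin n → ℂ)) ∘ₗ ρ.asAlgebraHom.toLinearMap ∘ₗ e.symm.toLinearMap
      have hf : ∀ A B, f (A * B) = f (B * A) := by
        intro A B
        simp only [f, LinearMap.comp_apply, AlgEquiv.toLinearMap_apply, AlgHom.toLinearMap_apply,
          map_mul]
        exact LinearMap.trace_mul_comm _ _ _
      obtain ⟨c, hc⟩ := Matrix.exists_eq_sum_mul_trace_of_map_mul_comm f hf
      have hρc (h : H) : ρ.character h = ∑ i, c i * (R i).character h := by
        have h1 : ρ.character h = f (e (MonoidAlgebra.of ℂ H h)) := by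
          simp [f, Representation.character]
        rw [h1, hc]
        exact Finset.sum_congr rfl fun i _ => by rw [hchar]; rfl
      have h0 (i) : (Nat.card H : ℂ)⁻¹ * ∑ g : H, (R i).character g * ρ.character g⁻¹ = 0 := by
        have := hirr i
        rw [Representation.char_orthonormal, if_neg]
        rintro ⟨φ⟩
        exact hno ⟨i, (Representation.char_iso φ).symm⟩
      have h1 := Representation.char_orthonormal ρ ρ
      rw [if_pos ⟨Representation.Equiv.refl ρ⟩] at h1
      have h2 : (Nat.card H : ℂ)⁻¹ * ∑ g : H, ρ.character g * ρ.character g⁻¹ =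
          ∑ i, c i * ((Nat.card H : ℂ)⁻¹ * ∑ g : H, (R i).character g * ρ.character g⁻¹) := by
        conv_lhs => enter [2, 2, g, 1]; rw [hρc]
        simp only [Finset.sum_mul, Finset.mul_sum]
        rw [Finset.sum_comm]
        exact Finset.sum_congr rfl fun i _ => Finset.sum_congr rfl fun g _ => by ring
      rw [h1] at h2
      simp only [h0, mul_zero, Finset.sum_const_zero] at h2
      exact one_ne_zero h2
  · intro i
    simp
  · have h1 := e.toLinearEquiv.finrank_eq
    rw [Module.finrank_pi_fintype] at h1
    simp only [Module.finrank_matrix, Fintype.card_fin, Module.finrank_self, mul_one] at h1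
    have h2 : Module.finrank ℂ (MonoidAlgebra ℂ H) = Nat.card H := by
      rw [Nat.card_eq_fintype_card]
      exact Module.finrank_eq_card_basis (MonoidAlgebra.basis H ℂ)
    rw [← h2, h1]
    simp [sq]

/-! ### Extension of invariant representations -/

/-- Schur's lemma for an endomorphism commuting with an irreducible representation. -/
theorem Representation.IsIrreducible.exists_eq_smul_one {H V : Type*} [Group H]
    [AddCommGroup V] [Module ℂ V] [FiniteDimensional ℂ V] {ρ : Representation ℂ H V}
    (hρ : ρ.IsIrreducible) (T : Module.End ℂ V) (hT : ∀ h, T * ρ h = ρ h * T) :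
    ∃ c : ℂ, T = c • (1 : Module.End ℂ V) := by
  obtain ⟨c, hc⟩ := (Representation.IsIrreducible.algebraMap_intertwiningMap_bijective_of_isAlgClosed
    (ρ := ρ)).2 ⟨T, hT⟩
  exact ⟨c, (congrArg Representation.IntertwiningMap.toLinearMap hc).symm⟩

theorem Representation.IsIrreducible.comp_of_surjective {H K V : Type*} [Group H] [Group K]
    [AddCommGroup V] [Module ℂ V] {ρ : Representation ℂ H V}
    (hρ : ρ.IsIrreducible) (f : K →* H) (hf : Function.Surjective f) :
    Representation.IsIrreducible (ρ.comp f : Representation ℂ K V) := by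
  rw [Representation.isIrreducible_iff_submodule] at hρ ⊢
  refine ⟨hρ.1, fun W hW => hρ.2 W fun g v hv => ?_⟩
  obtain ⟨k, rfl⟩ := hf g
  exact hW k v hv

theorem Representation.IsIrreducible.of_comp {H K V : Type*} [Group H] [Group K]
    [AddCommGroup V] [Module ℂ V] {ρ : Representation ℂ H V} {f : K →* H}
    (hρ : Representation.IsIrreducible (ρ.comp f : Representation ℂ K V)) :
    ρ.IsIrreducible := by
  rw [Representation.isIrreducible_iff_submodule] at hρ ⊢
  exact ⟨hρ.1, fun W hW => hρ.2 W fun k v hv => hW (f k) v hv⟩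

theorem isPGroup_quotient_subgroupOf {G : Type*} [Group G] {M N : Subgroup G} [M.Normal] {p : ℕ}
    (hpow : ∀ x ∈ N, ∃ k, x ^ p ^ k ∈ M) : IsPGroup p (N ⧸ M.subgroupOf N) := by
  intro x
  induction x using QuotientGroup.induction_on with
  | H x =>
    obtain ⟨k, hk⟩ := hpow x x.2
    exact ⟨k, (QuotientGroup.eq_one_iff (x ^ p ^ k)).mpr hk⟩

section Extension

variable {G : Type*} [Group G] {M N : Subgroup G} [M.Normal]
  {V : Type*} [AddCommGroup V] [Module ℂ V]

/-- The pairs of an element `x` of `N` and an operator `T` with `T ^ e` of determinant one which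
carries the representation `ρ` of `M` to its conjugate by `x`. -/
def intertwinerGroup (N : Subgroup G) (ρ : Representation ℂ M V) (e : ℕ) :
    Subgroup (N × (Module.End ℂ V)ˣ) where
  carrier := {y | (∀ m, (y.2 : Module.End ℂ V) * ρ m = ρ (MulAut.conjNormal (y.1 : G) m) * y.2) ∧
    LinearMap.det (y.2 : Module.End ℂ V) ^ e = 1}
  one_mem' := by simp
  mul_mem' := by
    rintro ⟨x, S⟩ ⟨y, T⟩ ⟨hS, hS'⟩ ⟨hT, hT'⟩
    refine ⟨fun m => ?_, ?_⟩
    · simp only [Prod.fst_mul, Prod.snd_mul, Units.val_mul, Subgroup.coe_mul, map_mul,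
        MulAut.mul_apply] at *
      rw [mul_assoc, hT, ← mul_assoc, hS, mul_assoc]
    · simp only [Prod.snd_mul, Units.val_mul, map_mul, mul_pow] at *
      rw [hS', hT', one_mul]
  inv_mem' := by
    rintro ⟨x, S⟩ ⟨hS, hS'⟩
    refine ⟨fun m => ?_, ?_⟩
    · simp only [Prod.fst_inv, Prod.snd_inv, Subgroup.coe_inv, map_inv] at *
      have := hS ((MulAut.conjNormal (x : G))⁻¹ m)
      rw [MulAut.apply_inv_self] at this
      rw [Units.inv_mul_eq_iff_eq_mul, ← mul_assoc, this, mul_assoc, Units.mul_inv, mul_one]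
    · simp only [Prod.snd_inv] at *
      simp [hS']

variable [FiniteDimensional ℂ V]

/-- The elements of the intertwiner group over the identity are scalars of bounded order. -/
theorem exists_scalar_of_mem_intertwinerGroup {ρ : Representation ℂ M V} (hρ : ρ.IsIrreducible)
    {e : ℕ} {T : (Module.End ℂ V)ˣ} (hT : ((1 : N), T) ∈ intertwinerGroup N ρ e) :
    ∃ c : ℂ, (T : Module.End ℂ V) = c • 1 ∧ c ^ (Module.finrank ℂ V * e) = 1 := by
  obtain ⟨h1, h2⟩ := hT
  obtain ⟨c, hc⟩ := hρ.exists_eq_smul_one (T : Module.End ℂ V) (by simpa using h1)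
  refine ⟨c, hc, ?_⟩
  simp only at h2
  rw [hc, LinearMap.det_smul, map_one, mul_one, ← pow_mul] at h2
  exact h2

theorem finite_intertwinerGroup [Finite N] {ρ : Representation ℂ M V} (hρ : ρ.IsIrreducible)
    {e : ℕ} (he : Module.finrank ℂ V * e ≠ 0) : Finite (intertwinerGroup N ρ e) := by
  let f : intertwinerGroup N ρ e →* N := (MonoidHom.fst _ _).comp (Subgroup.subtype _)
  have hker : Finite f.ker := by
    have key : ∀ y : f.ker, ∃ c : ℂ, (y.1.1.2 : Module.End ℂ V) = c • 1 ∧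
        c ^ (Module.finrank ℂ V * e) = 1 := by
      rintro ⟨⟨⟨x, T⟩, hT⟩, hx⟩
      obtain rfl : x = 1 := hx
      exact exists_scalar_of_mem_intertwinerGroup hρ hT
    choose c hc hc' using key
    have hfin : {z : ℂ | z ^ (Module.finrank ℂ V * e) = 1}.Finite := by
      refine (Polynomial.nthRoots (Module.finrank ℂ V * e) (1 : ℂ)).toFinset.finite_toSet.subset ?_
      intro z hz
      simpa [Polynomial.mem_nthRoots (Nat.pos_of_ne_zero he)] using hz
    have := hfin.to_subtype
    refine Finite.of_injective
      (fun y => (⟨c y, hc' y⟩ : {z : ℂ | z ^ (Module.finrank ℂ V * e) = 1})) ?_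
    intro y z hyz
    have h1 : c y = c z := congrArg Subtype.val hyz
    have hy : y.1.1.1 = 1 := y.2
    have hz : z.1.1.1 = 1 := z.2
    apply Subtype.ext
    apply Subtype.ext
    refine Prod.ext (hy.trans hz.symm) (Units.ext ?_)
    rw [hc, hc, h1]
  have : Finite (intertwinerGroup N ρ e ⧸ f.ker) :=
    Finite.of_equiv _ (QuotientGroup.quotientKerEquivRange f).symm.toEquiv
  exact Finite.of_subgroup_quotient f.ker

/-- If the character of `ρ` is invariant under `N`, every element of `N` has an intertwiner, which
can be scaled to have determinant one. -/
theorem exists_mem_intertwinerGroup [Finite G] {ρ : Representation ℂ M V} (hρ : ρ.IsIrreducible)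
    (hinv : ∀ x ∈ N, ∀ m, ρ.character (MulAut.conjNormal x m) = ρ.character m) (e : ℕ) (x : N) :
    ∃ T, (x, T) ∈ intertwinerGroup N ρ e := by
  have hV : Module.finrank ℂ V ≠ 0 := by
    have := ((Representation.isIrreducible_iff_submodule ρ).mp hρ).1
    exact Module.finrank_pos.ne'
  let ρ' : Representation ℂ M V := ρ.comp (MulAut.conjNormal (x : G)).toMonoidHom
  have hρ' : ρ'.IsIrreducible := hρ.comp_of_surjective _ (MulAut.conjNormal (x : G)).surjective
  obtain ⟨φ⟩ := ρ.nonempty_equiv_of_character_eq ρ' hρ hρ' (by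
    ext m; exact (hinv x x.2 m).symm)
  have hφ : ∀ m, φ.toLinearEquiv.toLinearMap ∘ₗ ρ m =
      ρ (MulAut.conjNormal (x : G) m) ∘ₗ φ.toLinearEquiv.toLinearMap := φ.isIntertwining'
  have hdet : LinearMap.det φ.toLinearEquiv.toLinearMap ≠ 0 := φ.toLinearEquiv.isUnit_det'.ne_zero
  obtain ⟨c, hc⟩ := IsAlgClosed.exists_pow_nat_eq (LinearMap.det φ.toLinearEquiv.toLinearMap)⁻¹
    (Nat.pos_of_ne_zero hV)
  have hc0 : c ≠ 0 := by
    rintro rfl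
    rw [zero_pow hV] at hc
    exact inv_ne_zero hdet hc.symm
  have hd1 : LinearMap.det (c • φ.toLinearEquiv.toLinearMap) = 1 := by
    rw [LinearMap.det_smul, hc, inv_mul_cancel₀ hdet]
  obtain ⟨T, hT⟩ : IsUnit (c • φ.toLinearEquiv.toLinearMap : Module.End ℂ V) := by
    rw [LinearMap.isUnit_iff_isUnit_det, hd1]
    exact isUnit_one
  refine ⟨T, fun m => ?_, ?_⟩
  · simp only [hT]
    ext v
    have := LinearMap.congr_fun (hφ m) v
    simp only [LinearMap.comp_apply] at this
    simp only [Module.End.mul_apply, LinearMap.smul_apply, map_smul]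
    rw [this]
  · simp only [hT, hd1, one_pow]

/-- Extension of invariant representations in coprime situations: if `N / M` is a `p`-group and
`p` divides neither the degree nor the determinantal order of an irreducible representation of `M`
with `N`-invariant character, then the representation extends to `N`, with the same bound on the
determinantal order. -/
theorem Representation.exists_extension [Finite G] {p : ℕ} (hp : p.Prime) (hMN : M ≤ N)
    (hpow : ∀ x ∈ N, ∃ k, x ^ p ^ k ∈ M) {ρ : Representation ℂ M V} (hρ : ρ.IsIrreducible)
    (hinv : ∀ x ∈ N, ∀ m, ρ.character (MulAut.conjNormal x m) = ρ.character m)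
    {e : ℕ} (hdeg : p.Coprime (Module.finrank ℂ V)) (he : p.Coprime e)
    (hdet : ∀ m, LinearMap.det (ρ m) ^ e = 1) :
    ∃ σ : Representation ℂ N V, (∀ m, σ (Subgroup.inclusion hMN m) = ρ m) ∧
      ∀ x, LinearMap.det (σ x) ^ e = 1 := by
  have := Fact.mk hp
  have hpe : p.Coprime (Module.finrank ℂ V * e) := Nat.Coprime.mul_right hdeg he
  have hne : Module.finrank ℂ V * e ≠ 0 := by
    rintro h0
    rw [h0, Nat.coprime_zero_right] at hpe
    exact hp.one_lt.ne' hpe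
  have := finite_intertwinerGroup (N := N) hρ hne
  let E := intertwinerGroup N ρ e
  let f : E →* N := (MonoidHom.fst _ _).comp (Subgroup.subtype _)
  have hf : Function.Surjective f := fun x => by
    obtain ⟨T, hT⟩ := exists_mem_intertwinerGroup hρ hinv e x
    exact ⟨⟨_, hT⟩, rfl⟩
  let j : M →* E :=
    { toFun := fun m => ⟨(Subgroup.inclusion hMN m, MonoidHom.toHomUnits ρ m), by
        refine ⟨fun m' => ?_, hdet m⟩
        change ρ m * ρ m' = ρ _ * ρ m
        rw [← map_mul, ← map_mul]
        congr 1
        ext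
        simp⟩
      map_one' := by ext <;> simp
      map_mul' := fun a b => by ext <;> simp }
  have hfj (m : M) : f (j m) = Subgroup.inclusion hMN m := rfl
  have hjnormal : j.range.Normal := by
    refine ⟨?_⟩
    rintro _ ⟨m, rfl⟩ ⟨⟨x, T⟩, hT⟩
    refine ⟨MulAut.conjNormal (x : G) m, ?_⟩
    rw [eq_mul_inv_iff_mul_eq]
    apply Subtype.ext
    refine Prod.ext ?_ (Units.ext ?_)
    · ext
      simp [j]
    · exact (hT.1 m).symm
  obtain ⟨P⟩ : Nonempty (Sylow p E) := inferInstance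
  let Q : Subgroup E := P ⊔ j.range
  -- `Q` meets the `p'`-group of scalars trivially, as `Q / M` is a `p`-group.
  have hinj : ∀ z ∈ Q, f z = 1 → z = 1 := by
    intro z hz hz1
    obtain ⟨y, hy, _, ⟨m, rfl⟩, rfl⟩ := Subgroup.mem_sup_of_normal_right.mp hz
    obtain ⟨k, hk⟩ := P.isPGroup' ⟨y, hy⟩
    have hk : y ^ p ^ k = 1 := congrArg Subtype.val hk
    set z := y * j m with hzdef
    obtain ⟨c, hc, hc1⟩ : ∃ c : ℂ, (z.1.2 : Module.End ℂ V) = c • 1 ∧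
        c ^ (Module.finrank ℂ V * e) = 1 := by
      refine exists_scalar_of_mem_intertwinerGroup (N := N) hρ ?_
      have : z.1 = (1, z.1.2) := Prod.ext hz1 rfl
      rw [← this]
      exact z.2
    have hzo : z ^ (Module.finrank ℂ V * e) = 1 := by
      apply Subtype.ext
      refine Prod.ext ?_ (Units.ext ?_)
      · change (f z) ^ _ = 1
        rw [hz1, one_pow]
      · change (z.1.2 : Module.End ℂ V) ^ _ = 1
        rw [hc, smul_pow, hc1, one_pow, one_smul]
    have hzcomm : Commute z (j m)⁻¹ := by
      apply Commute.inv_right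
      apply Subtype.ext
      refine Prod.ext ?_ (Units.ext ?_)
      · change f z * f (j m) = f (j m) * f z
        rw [hz1, one_mul, mul_one]
      · change (z.1.2 : Module.End ℂ V) * ρ m = ρ m * z.1.2
        rw [hc, smul_mul_assoc, mul_smul_comm, one_mul, mul_one]
    have hzp : z ^ p ^ k = j (m ^ p ^ k) := by
      have : y = z * (j m)⁻¹ := by rw [hzdef, mul_inv_cancel_right]
      rw [this, hzcomm.mul_pow, inv_pow, mul_inv_eq_one] at hk
      rw [hk, map_pow]
    have hm : m ^ p ^ k = 1 := by
      apply Subgroup.inclusion_injective hMN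
      rw [← hfj, ← hzp, map_pow, hz1, one_pow, map_one]
    rw [hm, map_one] at hzp
    have h1 := orderOf_dvd_of_pow_eq_one hzp
    have h2 := orderOf_dvd_of_pow_eq_one hzo
    rw [← orderOf_eq_one_iff]
    exact Nat.eq_one_of_dvd_coprimes (hpe.pow_left k) h1 h2
  -- The index of the image of `Q` in `N` is prime to `p` and a power of `p`.
  have hsurj : Q.map f = ⊤ := by
    rw [← Subgroup.index_eq_one]
    have h1 : (Q.map f).index ∣ (P : Subgroup E).index :=
      (Q.index_map_dvd hf).trans (Subgroup.index_dvd_of_le le_sup_left)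
    have h2 : M.subgroupOf N ≤ Q.map f := by
      intro x hx
      exact ⟨j ⟨x, hx⟩, Subgroup.mem_sup_right ⟨_, rfl⟩, rfl⟩
    obtain ⟨k, hk⟩ := IsPGroup.iff_card.mp (isPGroup_quotient_subgroupOf hpow)
    have h4 : (Q.map f).index ∣ p ^ k := hk ▸ Subgroup.index_dvd_of_le h2
    refine Nat.eq_one_of_dvd_coprimes (Nat.Coprime.pow_left k ?_) h4 h1
    exact (Nat.Prime.coprime_iff_not_dvd hp).mpr P.not_dvd_index
  let F : Q ≃* N := MulEquiv.ofBijective (f.comp Q.subtype) (by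
    constructor
    · rw [injective_iff_map_eq_one]
      rintro ⟨z, hz⟩ hz1
      exact Subtype.ext (hinj z hz hz1)
    · intro x
      obtain ⟨z, hz, rfl⟩ : x ∈ Q.map f := hsurj ▸ Subgroup.mem_top x
      exact ⟨⟨z, hz⟩, rfl⟩)
  refine ⟨(Units.coeHom _).comp ((MonoidHom.snd _ _).comp (E.subtype.comp
    (Q.subtype.comp F.symm.toMonoidHom))), fun m => ?_, fun x => ?_⟩
  · have : F.symm (Subgroup.inclusion hMN m) = ⟨j m, Subgroup.mem_sup_right ⟨_, rfl⟩⟩ := by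
      rw [MulEquiv.symm_apply_eq]
      rfl
    change (((F.symm (Subgroup.inclusion hMN m) : Q) : E).1.2 : Module.End ℂ V) = ρ m
    rw [this]
    rfl
  · exact (F.symm x : E).2.2

/-- The extension is unique: the ratio of two extensions is a scalar whose order is both a power
of `p` and prime to `p`. -/
theorem Representation.character_eq_of_extensions [Finite G] {p : ℕ} (hMN : M ≤ N)
    (hpow : ∀ x ∈ N, ∃ k, x ^ p ^ k ∈ M) (σ τ : Representation ℂ N V)
    (hσ : Representation.IsIrreducible (σ.comp (Subgroup.inclusion hMN)))
    (hτ : Representation.IsIrreducible (τ.comp (Subgroup.inclusion hMN)))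
    (hστ : ∀ m, σ.character (Subgroup.inclusion hMN m) = τ.character (Subgroup.inclusion hMN m))
    {e : ℕ} (hpe : p.Coprime (Module.finrank ℂ V * e))
    (hdσ : ∀ x, LinearMap.det (σ x) ^ e = 1) (hdτ : ∀ x, LinearMap.det (τ x) ^ e = 1) :
    σ.character = τ.character := by
  obtain ⟨φ⟩ := Representation.nonempty_equiv_of_character_eq (σ.comp (Subgroup.inclusion hMN))
    (τ.comp (Subgroup.inclusion hMN)) hσ hτ (funext hστ)
  obtain ⟨A, hA⟩ : IsUnit (φ.toLinearEquiv.toLinearMap : Module.End ℂ V) :=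
    (LinearMap.isUnit_iff_isUnit_det _).mpr φ.toLinearEquiv.isUnit_det'
  let s : N →* (Module.End ℂ V)ˣ := MonoidHom.toHomUnits σ
  let t : N →* (Module.End ℂ V)ˣ := (MulAut.conj A⁻¹).toMonoidHom.comp (MonoidHom.toHomUnits τ)
  have ht (x : N) : t x = A⁻¹ * MonoidHom.toHomUnits τ x * A := by simp [t]
  have hM (x : N) (hx : (x : G) ∈ M) : t x = s x := by
    rw [ht, mul_assoc, inv_mul_eq_iff_eq_mul]
    apply Units.ext
    have := φ.isIntertwining' ⟨x, hx⟩
    simp only [Units.val_mul, hA]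
    exact this.symm
  funext x
  have hu (y : N) (hy : (y : G) ∈ M) : (s x)⁻¹ * t x * s y = s y * ((s x)⁻¹ * t x) := by
    have h1 : t (x * y * x⁻¹) = s (x * y * x⁻¹) := hM _ (Subgroup.Normal.conj_mem ‹_› _ hy _)
    simp only [map_mul, map_inv, hM y hy] at h1
    have h2 : t x * s y = s x * s y * (s x)⁻¹ * t x := by rw [← h1]; group
    rw [mul_assoc, h2]
    group
  set u := (s x)⁻¹ * t x with hudef
  obtain ⟨c, hc⟩ := hσ.exists_eq_smul_one (u : Module.End ℂ V) fun m =>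
    congrArg Units.val (hu (Subgroup.inclusion hMN m) m.2)
  have htx : t x = s x * u := by rw [hudef, mul_inv_cancel_left]
  have hcomm : Commute (s x) u := by
    apply Units.ext
    simp only [Units.val_mul, hc, smul_mul_assoc, mul_smul_comm, one_mul, mul_one]
  obtain ⟨k, hk⟩ := hpow x x.2
  have hup : u ^ p ^ k = 1 := by
    have h1 : t (x ^ p ^ k) = s (x ^ p ^ k) := hM _ hk
    rw [map_pow, map_pow, htx, hcomm.mul_pow] at h1
    exact mul_eq_left.mp h1
  have hdet : LinearMap.det (u : Module.End ℂ V) ^ e = 1 := by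
    let D : (Module.End ℂ V)ˣ →* ℂˣ := Units.map LinearMap.det
    have h1 : D (MonoidHom.toHomUnits τ x) ^ e = 1 := Units.ext (hdτ x)
    have h2 : D (s x) ^ e = 1 := Units.ext (hdσ x)
    have h3 : D u ^ e = 1 := by
      rw [hudef, ht]
      simp only [map_mul, map_inv, mul_pow, inv_pow, h1, h2]
      simp
    exact congrArg Units.val h3
  have hun : u ^ (Module.finrank ℂ V * e) = 1 := by
    rw [hc, LinearMap.det_smul, map_one, mul_one, ← pow_mul] at hdet
    apply Units.ext
    rw [Units.val_pow_eq_pow_val, hc, smul_pow, hdet, one_pow, one_smul, Units.val_one]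
  have hu1 : u = 1 := by
    rw [← orderOf_eq_one_iff]
    exact Nat.eq_one_of_dvd_coprimes (hpe.pow_left k) (orderOf_dvd_of_pow_eq_one hup)
      (orderOf_dvd_of_pow_eq_one hun)
  rw [hu1, mul_one, ht] at htx
  have h1 : σ x = ((A⁻¹ : (Module.End ℂ V)ˣ) : Module.End ℂ V) * τ x * A :=
    (congrArg Units.val htx).symm
  rw [Representation.character, Representation.character, h1, LinearMap.trace_mul_comm,
    ← mul_assoc, Units.mul_inv, one_mul]

end Extension

/-! ### Conjugate characters and inertia groups -/

section Conjugation

variable {G : Type*} [Group G] {N : Subgroup G} [N.Normal]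

theorem conjFun_one (θ : N → ℂ) : conjFun θ (1 : G) = θ := by
  funext x; simp [conjFun]

theorem conjFun_conjFun (θ : N → ℂ) (g h : G) :
    conjFun (conjFun θ g) h = conjFun θ (g * h) := by
  funext x; simp [conjFun]

theorem conjFun_apply_one (θ : N → ℂ) (g : G) : conjFun θ g 1 = θ 1 := by simp [conjFun]

/-- Conjugation as a left action: `g` sends `θ` to its conjugate by `g⁻¹`, since
`θ ↦ conjFun θ g` is a right action. -/
abbrev conjMulAction (N : Subgroup G) [N.Normal] : MulAction G (N → ℂ) where
  smul g θ := conjFun θ g⁻¹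
  one_smul θ := by change conjFun θ 1⁻¹ = θ; rw [inv_one, conjFun_one]
  mul_smul g h θ := by
    change conjFun θ (g * h)⁻¹ = conjFun (conjFun θ h⁻¹) g⁻¹
    rw [conjFun_conjFun, mul_inv_rev]

/-- The inertia group of `θ`. -/
def inertiaGroup (θ : N → ℂ) : Subgroup G :=
  let _ := conjMulAction N
  MulAction.stabilizer G θ

theorem mem_inertiaGroup {θ : N → ℂ} {g : G} : g ∈ inertiaGroup θ ↔ conjFun θ g = θ := by
  have h : g⁻¹ ∈ inertiaGroup θ ↔ conjFun θ g⁻¹⁻¹ = θ := Iff.rfl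
  rw [← inv_mem_iff, h, inv_inv]

theorem orbit_conjMulAction (θ : N → ℂ) :
    (letI := conjMulAction N; MulAction.orbit G θ) = Set.range (conjFun (G := G) θ) :=
  (Equiv.inv G).surjective.range_comp (conjFun (G := G) θ)

theorem index_inertiaGroup (θ : N → ℂ) :
    (inertiaGroup θ).index = (Set.range (conjFun (G := G) θ)).ncard := by
  let _ := conjMulAction N
  rw [← orbit_conjMulAction θ]
  exact MulAction.index_stabilizer G θ

theorem orbitSum_apply_one [Finite G] (θ : N → ℂ) :
    orbitSum (G := G) θ 1 = (inertiaGroup θ).index * θ 1 := by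
  rw [orbitSum, Finset.sum_apply, index_inertiaGroup,
    Set.ncard_eq_toFinset_card _ (Set.finite_range _), ← nsmul_eq_mul]
  refine Finset.sum_eq_card_nsmul fun φ hφ => ?_
  obtain ⟨g, rfl⟩ := (Set.Finite.mem_toFinset _).mp hφ
  exact conjFun_apply_one θ g

theorem conjFun_mem_Irr {θ : N → ℂ} (hθ : θ ∈ Irr N) (g : G) : conjFun θ g ∈ Irr N := by
  obtain ⟨n, ρ, hρ, rfl⟩ := hθ
  exact ⟨n, _, hρ.comp_of_surjective (MulAut.conjNormal g : MulAut N).toMonoidHom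
    (MulAut.conjNormal g : MulAut N).surjective, rfl⟩

end Conjugation

/-! ### Descent of the degree condition to a normal subgroup of `p`-power index -/

section Descent

variable {G : Type*} [Group G] [Finite G] {M N : Subgroup G} [M.Normal] [N.Normal] {p : ℕ}

/-- If a `G`-orbit of characters of `M` has length prime to `p` and `N / M` is a `p`-group, then
`N`, having orbits of equal length a power of `p` on it, acts trivially. -/
theorem le_inertiaGroup (hp : p.Prime) (hpow : ∀ x ∈ N, ∃ k, x ^ p ^ k ∈ M)
    (φ : M → ℂ) (hM : M ≤ inertiaGroup φ)
    (hφ : ¬ p ∣ (inertiaGroup φ).index) : N ≤ inertiaGroup φ := by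
  have := Fact.mk hp
  set T : Subgroup G := inertiaGroup φ
  obtain ⟨k, hk⟩ := IsPGroup.iff_card.mp (isPGroup_quotient_subgroupOf hpow)
  have h4 : T.relIndex N ∣ p ^ k := hk ▸ Subgroup.index_dvd_of_le (Subgroup.comap_mono hM)
  have h5 : T.relIndex N ∣ T.index := by
    obtain ⟨a, ha⟩ := N.relIndex_dvd_index_of_normal T
    have h6 : T.relIndex N * N.index = N.relIndex T * T.index := by
      rw [← Subgroup.inf_relIndex_right T N, ← Subgroup.inf_relIndex_left T N,
        Subgroup.relIndex_mul_index inf_le_right, Subgroup.relIndex_mul_index inf_le_left]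
    refine ⟨a, ?_⟩
    have h7 : N.relIndex T ≠ 0 := (N.subgroupOf T).index_ne_zero_of_finite
    apply Nat.eq_of_mul_eq_mul_left (Nat.pos_of_ne_zero h7)
    rw [← h6, ha]
    ring
  rw [← Subgroup.relIndex_eq_one]
  exact Nat.eq_one_of_dvd_coprimes
    (Nat.Coprime.pow_left k ((Nat.Prime.coprime_iff_not_dvd hp).mpr hφ)) h4 h5

/-- An irreducible character of `M` whose orbit sum has degree prime to `p` is linear and
invariant, if this holds for the characters of `N`: it has a unique extension to `N` of
determinantal order prime to `p`, and by uniqueness the extension has an orbit of the same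
length. -/
theorem mem_LinInvChar_of_not_dvd (hp : p.Prime) (hMN : M ≤ N)
    (hpow : ∀ x ∈ N, ∃ k, x ^ p ^ k ∈ M) {e : ℕ} (he : p.Coprime e)
    (hlin : ∀ (f : M →* ℂˣ) (m : M), f m ^ e = 1)
    (h : ∀ ψ ∈ MinInvChar N \ LinInvChar N, ∃ d : ℕ, ψ 1 = (d : ℂ) ∧ p ∣ d)
    {n : ℕ} {ρ : Representation ℂ M (Fin n → ℂ)} (hρ : ρ.IsIrreducible)
    (hn : ¬ p ∣ n) (hT : ¬ p ∣ (inertiaGroup ρ.character).index) :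
    ρ.character ∈ LinInvChar M := by
  have hMT : M ≤ inertiaGroup ρ.character := by
    intro x hx
    rw [mem_inertiaGroup]
    funext m
    have : MulAut.conjNormal x m = ⟨x, hx⟩ * m * ⟨x, hx⟩⁻¹ := Subtype.ext (by simp)
    rw [conjFun, this, Representation.char_conj]
  have hNT := le_inertiaGroup hp hpow _ hMT hT
  have hfr : Module.finrank ℂ (Fin n → ℂ) = n := by simp
  have hdeg : p.Coprime (Module.finrank ℂ (Fin n → ℂ)) := by
    rw [hfr]
    exact (Nat.Prime.coprime_iff_not_dvd hp).mpr hn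
  obtain ⟨σ, hσρ, hdσ⟩ := Representation.exists_extension hp hMN hpow hρ
    (fun x hx m => congrFun (mem_inertiaGroup.mp (hNT hx)) m) hdeg he
    (fun m => congrArg Units.val
      (hlin ((Units.map LinearMap.det).comp (MonoidHom.toHomUnits ρ)) m))
  have hres : (σ.comp (Subgroup.inclusion hMN) : Representation ℂ M (Fin n → ℂ)) = ρ :=
    MonoidHom.ext hσρ
  have hσM : Representation.IsIrreducible
      (σ.comp (Subgroup.inclusion hMN) : Representation ℂ M (Fin n → ℂ)) := hres ▸ hρ
  have hσ : σ.IsIrreducible := hσM.of_comp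
  have hchar (m : M) : σ.character (Subgroup.inclusion hMN m) = ρ.character m := by
    rw [Representation.character, hσρ, Representation.character]
  have hconj (g : G) (m : M) : MulAut.conjNormal g (Subgroup.inclusion hMN m) =
      Subgroup.inclusion hMN (MulAut.conjNormal g m) := Subtype.ext (by simp)
  have hle : (inertiaGroup ρ.character : Subgroup G) ≤ inertiaGroup σ.character := by
    intro g hg
    rw [mem_inertiaGroup] at hg ⊢
    let τ : Representation ℂ N (Fin n → ℂ) :=
      σ.comp (MulAut.conjNormal g : MulAut N).toMonoidHom
    refine (Representation.character_eq_of_extensions hMN hpow σ τ hσM ?_ ?_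
      (Nat.Coprime.mul_right hdeg he) hdσ (fun x => hdσ _)).symm
    · have : τ.comp (Subgroup.inclusion hMN) =
          ρ.comp (MulAut.conjNormal g : MulAut M).toMonoidHom := by
        ext1 m
        change σ (MulAut.conjNormal g (Subgroup.inclusion hMN m)) = ρ (MulAut.conjNormal g m)
        rw [hconj, hσρ]
      rw [this]
      exact hρ.comp_of_surjective _ (MulAut.conjNormal g : MulAut M).surjective
    · intro m
      change _ = σ.character (MulAut.conjNormal g (Subgroup.inclusion hMN m))
      rw [hconj, hchar, hchar]
      exact (congrFun hg m).symm
  have hT' : ¬ p ∣ (inertiaGroup σ.character).index := fun hd =>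
    hT (hd.trans (Subgroup.index_dvd_of_le hle))
  have hval : orbitSum (G := G) σ.character 1 =
      (((inertiaGroup σ.character).index * n : ℕ) : ℂ) := by
    rw [orbitSum_apply_one, Representation.char_one, hfr, Nat.cast_mul]
  have hlin1 : orbitSum (G := G) σ.character ∈ LinInvChar N := by
    by_contra hno
    obtain ⟨d, hd, hpd⟩ := h _ ⟨⟨_, ⟨n, σ, hσ, rfl⟩, rfl⟩, hno⟩
    rw [hval] at hd
    rw [← Nat.cast_injective hd] at hpd
    rcases (Nat.Prime.dvd_mul hp).mp hpd with h1 | h1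
    · exact hT' h1
    · exact hn h1
  have h1 := hlin1.2.1
  rw [hval, Nat.cast_eq_one, mul_eq_one] at h1
  refine ⟨⟨n, ρ, hρ, rfl⟩, ?_, fun g => ?_⟩
  · rw [Representation.char_one, hfr, h1.2, Nat.cast_one]
  · have hg : g ∈ inertiaGroup σ.character := by
      rw [Subgroup.index_eq_one.mp h1.1]
      trivial
    rw [mem_inertiaGroup] at hg
    funext m
    have := congrFun hg (Subgroup.inclusion hMN m)
    rw [conjFun, hconj, hchar, hchar] at this
    exact this

end Descent

/-! ### Counting characters modulo `p` -/

section Counting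

variable {G : Type*} [Group G] (M : Subgroup G) [M.Normal]

/-- Counting the squares of the degrees over the conjugation orbits modulo `p`: orbits of
characters other than the invariant linear ones do not contribute. -/
theorem dvd_ncard_LinInvChar [Finite G] {p : ℕ}
    (hlin : ∀ φ ∈ Irr M, ∀ n : ℕ, φ 1 = n → ¬ p ∣ n → ¬ p ∣ (inertiaGroup φ).index →
      φ ∈ LinInvChar M) (hM : p ∣ Nat.card M) :
    (LinInvChar M).Finite ∧ p ∣ (LinInvChar M).ncard := by
  classical
  obtain ⟨k, d, χ, hinj, hrange, hdeg, hsum⟩ := exists_irr_enumeration M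
  have hfin : (Irr M).Finite := hrange ▸ Set.finite_range χ
  have hLfin : (LinInvChar M).Finite := hfin.subset fun φ hφ => hφ.1
  refine ⟨hLfin, ?_⟩
  -- The degree of `φ`, with a junk value if `φ 1` is not a natural number.
  let deg (φ : M → ℂ) : ℕ := Function.invFun (Nat.cast : ℕ → ℂ) (φ 1)
  have hdeg_eq {φ : M → ℂ} {n : ℕ} (h : φ 1 = n) : deg φ = n := by
    simp only [deg, h]
    exact Function.leftInverse_invFun Nat.cast_injective n
  have hcast {φ : M → ℂ} (hφ : φ ∈ Irr M) : φ 1 = deg φ := by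
    rw [← hrange] at hφ
    obtain ⟨i, rfl⟩ := hφ
    rw [hdeg_eq (hdeg i), hdeg i]
  have hsum' : ∑ φ ∈ hfin.toFinset, deg φ ^ 2 = Nat.card M := by
    rw [← hsum]
    refine (Finset.sum_bij (fun i _ => χ i) (fun i _ => ?_) (fun i _ j _ h => hinj h)
      (fun φ hφ => ?_) (fun i _ => ?_)).symm
    · rw [Set.Finite.mem_toFinset, ← hrange]
      exact ⟨i, rfl⟩
    · rw [Set.Finite.mem_toFinset, ← hrange] at hφ
      obtain ⟨i, rfl⟩ := hφ
      exact ⟨i, Finset.mem_univ _, rfl⟩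
    · rw [hdeg_eq (hdeg i)]
  have hsplit : ∑ φ ∈ hfin.toFinset, deg φ ^ 2 =
      (LinInvChar M).ncard + ∑ φ ∈ hfin.toFinset \ hLfin.toFinset, deg φ ^ 2 := by
    have hsub : hLfin.toFinset ⊆ hfin.toFinset := by
      rw [Set.Finite.toFinset_subset_toFinset]
      exact fun φ hφ => hφ.1
    rw [← Finset.sum_sdiff hsub, add_comm, Set.ncard_eq_toFinset_card _ hLfin,
      Finset.card_eq_sum_ones]
    congr 1
    refine Finset.sum_congr rfl fun φ hφ => ?_
    rw [Set.Finite.mem_toFinset] at hφ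
    rw [hdeg_eq (n := 1) (by rw [hφ.2.1, Nat.cast_one]), one_pow]
  have hrest : p ∣ ∑ φ ∈ hfin.toFinset \ hLfin.toFinset, deg φ ^ 2 := by
    let _ := conjMulAction M
    rw [Finset.sum_partition (MulAction.orbitRel G (M → ℂ))]
    refine Finset.dvd_sum fun c hc => ?_
    obtain ⟨φ, hφ, rfl⟩ := Finset.mem_image.mp hc
    rw [Finset.mem_sdiff, Set.Finite.mem_toFinset, Set.Finite.mem_toFinset] at hφ
    have horb : {y ∈ hfin.toFinset \ hLfin.toFinset |
        (Quotient.mk (MulAction.orbitRel G (M → ℂ)) y) = Quotient.mk _ φ} =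
        (Set.finite_range (conjFun (G := G) φ)).toFinset := by
      ext ψ
      rw [Finset.mem_filter, Finset.mem_sdiff, Set.Finite.mem_toFinset, Set.Finite.mem_toFinset,
        Set.Finite.mem_toFinset, Quotient.eq, MulAction.orbitRel_apply, orbit_conjMulAction]
      refine ⟨fun h => h.2, fun h => ⟨?_, h⟩⟩
      obtain ⟨g, rfl⟩ := h
      refine ⟨conjFun_mem_Irr hφ.1 g, fun hL => hφ.2 ?_⟩
      have : conjFun φ g = φ := by
        have := hL.2.2 g⁻¹
        rw [conjFun_conjFun, mul_inv_cancel, conjFun_one] at this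
        exact this.symm
      rwa [this] at hL
    rw [horb, Finset.sum_const_nat (m := deg φ ^ 2),
      ← Set.ncard_eq_toFinset_card _ (Set.finite_range _), ← index_inertiaGroup]
    · by_contra hno
      refine hφ.2 (hlin φ hφ.1 (deg φ) (hcast hφ.1) (fun hd => hno ?_) (fun hd => hno ?_))
      · exact (hd.trans (dvd_pow_self _ two_ne_zero)).mul_left _
      · exact hd.mul_right _
    · intro ψ hψ
      obtain ⟨g, rfl⟩ := (Set.Finite.mem_toFinset _).mp hψ
      simp only [deg, conjFun_apply_one]
  rw [hsplit] at hsum'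
  exact (Nat.dvd_add_left hrest).mp (hsum' ▸ hM)

/-- The group of homomorphisms `M → ℂˣ` fixed by the conjugation action of `G`. -/
def invariantHoms : Subgroup (M →* ℂˣ) where
  carrier := {f | ∀ (g : G) (m : M), f (MulAut.conjNormal g m) = f m}
  one_mem' := by simp
  mul_mem' := by
    intro a b ha hb g m
    simp only [MonoidHom.mul_apply]
    rw [ha g m, hb g m]
  inv_mem' := by
    intro a ha g m
    simp only [MonoidHom.inv_apply]
    rw [ha g m]

theorem range_invariantHoms :
    Set.range (fun (f : invariantHoms M) (m : M) => (f.1 m : ℂ)) = LinInvChar M := by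
  apply Set.Subset.antisymm
  · rintro _ ⟨⟨f, hf⟩, rfl⟩
    let ρ : Representation ℂ M (Fin 1 → ℂ) :=
      { toFun := fun m => (f m : ℂ) • 1
        map_one' := by simp
        map_mul' := fun a b => by simp [smul_smul, mul_comm] }
    refine ⟨⟨1, ρ, ?_, ?_⟩, congrArg Units.val (map_one f), fun g => ?_⟩
    · rw [Representation.isIrreducible_iff_submodule]
      refine ⟨inferInstance, fun W _ => ?_⟩
      have : IsSimpleOrder (Submodule ℂ (Fin 1 → ℂ)) :=
        is_simple_module_of_finrank_eq_one (by rw [Module.finrank_fin_fun])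
      exact eq_bot_or_eq_top W
    · funext m
      simp [Representation.character, ρ]
    · funext m
      simp only [conjFun]
      rw [hf g m]
  · rintro φ ⟨⟨n, ρ, hρ, rfl⟩, h1, hinv⟩
    have hn : n = 1 := by
      rw [Representation.char_one, Module.finrank_fin_fun] at h1
      exact_mod_cast h1
    subst hn
    -- In dimension one the trace is the determinant.
    have hdet (m : M) : LinearMap.det (ρ m) = ρ.character m := by
      obtain ⟨A, hA⟩ := Matrix.toLin'.surjective (ρ m)
      rw [Representation.character, ← hA, LinearMap.det_toLin', Matrix.trace_toLin'_eq,
        Matrix.det_fin_one, Matrix.trace_fin_one]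
    let f : M →* ℂˣ := (Units.map LinearMap.det).comp (MonoidHom.toHomUnits ρ)
    have hf (m : M) : (f m : ℂ) = ρ.character m := hdet m
    refine ⟨⟨f, fun g m => Units.ext ?_⟩, funext hf⟩
    rw [hf, hf]
    exact congrFun (hinv g) m

/-- If `p` divides the number of invariant linear characters of `M`, then by Cauchy's theorem
there is one of order `p`. -/
theorem exists_orderOf_eq_of_dvd_ncard_LinInvChar {p : ℕ} (hp : p.Prime)
    (hfin : (LinInvChar M).Finite) (hdvd : p ∣ (LinInvChar M).ncard) :
    ∃ f : M →* ℂˣ, orderOf f = p := by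
  have := Fact.mk hp
  have hinj : Function.Injective (fun (f : invariantHoms M) (m : M) => (f.1 m : ℂ)) := by
    intro f g hfg
    apply Subtype.ext
    ext m
    exact congrFun hfg m
  rw [← range_invariantHoms] at hfin hdvd
  have := hfin.to_subtype
  have : Finite (invariantHoms M) := Finite.of_injective_finite_range hinj
  rw [← Nat.card_coe_set_eq, Nat.card_range_of_injective hinj] at hdvd
  obtain ⟨f, hf⟩ := exists_prime_orderOf_dvd_card' p hdvd
  exact ⟨f.1, by rw [Subgroup.orderOf_coe, hf]⟩

end Counting

/-! ### The subgroup generated by the elements of order prime to `p` -/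

section Residual

variable {G : Type*} [Group G]

/-- The subgroup `O^p(N)`, given by its generators, the elements of `N` of order prime to `p`. -/
def pResidual (p : ℕ) (N : Subgroup G) : Subgroup G :=
  Subgroup.closure {x | x ∈ N ∧ ¬ p ∣ orderOf x}

theorem pResidual_le (p : ℕ) (N : Subgroup G) : pResidual p N ≤ N :=
  (Subgroup.closure_le N).mpr fun _ hx => hx.1

instance pResidual_normal (p : ℕ) (N : Subgroup G) [hN : N.Normal] : (pResidual p N).Normal := by
  refine ⟨fun x hx g => ?_⟩
  have : pResidual p N ≤ (pResidual p N).comap (MulAut.conj g).toMonoidHom := by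
    refine (Subgroup.closure_le _).mpr fun x hx => ?_
    refine Subgroup.subset_closure ⟨hN.conj_mem x hx.1 g, ?_⟩
    rw [orderOf_injective (MulAut.conj g).toMonoidHom (MulAut.conj g).injective x]
    exact hx.2
  exact this hx

theorem exists_pow_mem_pResidual [Finite G] {p : ℕ} (hp : p.Prime) {N : Subgroup G} {x : G}
    (hx : x ∈ N) : ∃ k, x ^ p ^ k ∈ pResidual p N := by
  refine ⟨(orderOf x).factorization p, Subgroup.subset_closure ⟨pow_mem hx _, ?_⟩⟩
  rw [orderOf_pow_of_dvd (pow_ne_zero _ hp.ne_zero) (Nat.ordProj_dvd _ _)]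
  exact Nat.not_dvd_ordCompl hp (orderOf_pos x).ne'

theorem pResidual_hom_ext {p : ℕ} {N : Subgroup G} {A : Type*} [Group A]
    {f f' : pResidual p N →* A} (h : ∀ x, ¬ p ∣ orderOf x → f x = f' x) : f = f' := by
  apply MonoidHom.ext
  rintro ⟨x, hx⟩
  refine Subgroup.closure_induction (p := fun x hx => f ⟨x, hx⟩ = f' ⟨x, hx⟩)
    (fun x hx => ?_) ?_ (fun x y hx hy h1 h2 => ?_) (fun x hx h1 => ?_) hx
  · refine h _ ?_
    rw [← Subgroup.orderOf_coe]
    exact hx.2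
  · exact (map_one f).trans (map_one f').symm
  · exact (map_mul f ⟨x, hx⟩ ⟨y, hy⟩).trans
      ((congrArg₂ (· * ·) h1 h2).trans (map_mul f' ⟨x, hx⟩ ⟨y, hy⟩).symm)
  · exact (map_inv f ⟨x, hx⟩).trans ((congrArg _ h1).trans (map_inv f' ⟨x, hx⟩).symm)

/-- Since `O^p(N)` is generated by elements of order prime to `p`, its homomorphisms to abelian
groups are killed by the `p'`-part of its order. -/
theorem pResidual_hom_pow_eq_one [Finite G] {p : ℕ} {N : Subgroup G} {A : Type*}
    [CommGroup A] (f : pResidual p N →* A) (hp : p.Prime) (m : pResidual p N) :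
    f m ^ (Nat.card (pResidual p N) / p ^ (Nat.card (pResidual p N)).factorization p) = 1 := by
  set e := Nat.card (pResidual p N) / p ^ (Nat.card (pResidual p N)).factorization p with he
  have : f ^ e = 1 := by
    apply pResidual_hom_ext
    intro x hx
    rw [MonoidHom.pow_apply, ← map_pow, MonoidHom.one_apply]
    have h1 : orderOf x ∣ e := by
      refine Nat.Coprime.dvd_of_dvd_mul_left (m := p ^ (Nat.card (pResidual p N)).factorization p)
        ?_ ?_
      · exact Nat.Coprime.pow_right _ ((Nat.Prime.coprime_iff_not_dvd hp).mpr hx).symm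
      · rw [he, Nat.ordProj_mul_ordCompl_eq_self]
        exact orderOf_dvd_natCard x
    rw [orderOf_dvd_iff_pow_eq_one.mp h1, map_one]
  exact DFunLike.congr_fun this m

theorem orderOf_pResidual_hom_ne [Finite G] {p : ℕ} (hp : p.Prime) {N : Subgroup G}
    (f : pResidual p N →* ℂˣ) : orderOf f ≠ p := by
  intro hf
  have h1 : f ^ (Nat.card (pResidual p N) / p ^ (Nat.card (pResidual p N)).factorization p) = 1 :=
    MonoidHom.ext (pResidual_hom_pow_eq_one f hp)
  exact Nat.not_dvd_ordCompl hp Nat.card_pos.ne' (hf ▸ orderOf_dvd_of_pow_eq_one h1)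

end Residual

/-! ### The normal `p`-complement -/

theorem theorem3p8 {G : Type*} [Group G] [Finite G] (N : Subgroup G) [N.Normal]
    (p : ℕ) (hp : p.Prime)
    (h : ∀ ψ ∈ MinInvChar N \ LinInvChar N, ∃ d : ℕ, ψ 1 = (d : ℂ) ∧ p ∣ d) :
    HasNormalPComplement p N := by
  have := Fact.mk hp
  have hMN := pResidual_le p N
  have hpow : ∀ x ∈ N, ∃ k, x ^ p ^ k ∈ pResidual p N := fun x hx =>
    exists_pow_mem_pResidual hp hx
  have hcard : ¬ p ∣ Nat.card (pResidual p N) := by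
    intro hdvd
    obtain ⟨hfin, hd⟩ := dvd_ncard_LinInvChar (pResidual p N) (by
      rintro _ ⟨n, ρ, hρ, rfl⟩ n' hn hpn hT
      rw [Representation.char_one, Module.finrank_fin_fun] at hn
      obtain rfl : n = n' := Nat.cast_injective hn
      exact mem_LinInvChar_of_not_dvd hp hMN hpow
        (Nat.coprime_ordCompl hp Nat.card_pos.ne')
        (fun f m => pResidual_hom_pow_eq_one f hp m) h hρ hpn hT) hdvd
    obtain ⟨f, hf⟩ := exists_orderOf_eq_of_dvd_ncard_LinInvChar (pResidual p N) hp hfin hd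
    exact orderOf_pResidual_hom_ne hp f hf
  refine ⟨(pResidual p N).subgroupOf N, inferInstance, ?_, ?_⟩
  · rw [Nat.card_congr (Subgroup.subgroupOfEquivOfLe hMN).toEquiv]
    exact ((Nat.Prime.coprime_iff_not_dvd hp).mpr hcard).symm
  · exact IsPGroup.iff_card.mp (isPGroup_quotient_subgroupOf hpow)
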